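/- Let $S^1=\mathbb R/2\pi\mathbb Z$, let $n$ be odd, and let $V$ be an $n$-dimensional Chebyshev system on $S^1$, that is, an $n$-dimensional real vector space of continuous functions $S^1\to\mathbb R$ such that every nonzero function in $V$ has at most $n-1$ zeros on $S^1$. Let $f:S^1\to\mathbb R$ be a continuous function with at least $n+1$ sign changes: there are points $t_0<t_1<\dots<t_{n+1}\le t_0+2\pi$ with $f(t_i)f(t_{i+1})<0$ for $i=0,\dots,n$. Then there is an orientation-preserving $C^\infty$ diffeomorphism $\varphi$ of $S^1$ such that $f\circ\varphi$ is $L^2$-orthogonal to $V$: $$\int_0^{2\pi} f(\varphi(x))\,v(x)\,dx=0\qquad\text{for every } v\in V.$$ -/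

import Mathlib

open scoped Real ContDiff

/-- The circle `ℝ / 2πℤ`. -/
abbrev S1 : Type := AddCircle (2 * π)

/-- An `n`-dimensional Chebyshev system on the circle, `n` odd: an `n`-dimensional real vector
space of continuous functions on the circle, each nonzero element of which has at most `n - 1`
zeros. Zeros are counted as points; counting them with multiplicities (for differentiable
functions) would be a stronger requirement. -/
structure IsChebyshevSystem (n : ℕ) (V : Submodule ℝ C(S1, ℝ)) : Prop where
  odd : Odd n
  finrank_eq : Module.finrank ℝ V = n
  zeros_le : ∀ v ∈ V, v ≠ 0 → {x : S1 | v x = 0}.encard ≤ ((n - 1 : ℕ) : ℕ∞)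

/-- `f` has at least `m` sign changes on the circle: going once around the circle (from `t 0` to
`t 0 + 2π` at most) one meets points `t 0 < t 1 < ⋯ < t m` such that `f` has opposite strict signs
at any two consecutive ones. The last point may coincide, on the circle, with the first one, so
that the sign changes are counted cyclically. -/
def HasAtLeastSignChanges (f : S1 → ℝ) (m : ℕ) : Prop :=
  ∃ t : Fin (m + 1) → ℝ, StrictMono t ∧ t (Fin.last m) ≤ t 0 + 2 * π ∧
    ∀ i : Fin m, f (t i.castSucc : S1) * f (t i.succ : S1) < 0

/-- `φ` is an orientation-preserving (smooth) diffeomorphism of the circle: it has a smooth lift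
`Φ : ℝ → ℝ` with everywhere positive derivative and `Φ (x + 2π) = Φ x + 2π`. -/
def IsOrientationPreservingDiffeo (φ : S1 → S1) : Prop :=
  ∃ Φ : ℝ → ℝ, ContDiff ℝ ∞ Φ ∧ (∀ x, 0 < deriv Φ x) ∧
    (∀ x, Φ (x + 2 * π) = Φ x + 2 * π) ∧ ∀ x : ℝ, φ (x : S1) = (Φ x : S1)

/-! Since `n` is odd, `f` alternates in sign cyclically at points t_0 < ... < t_n < t_{n+1} = t_0 +
2π; let s_i be a zero of `f` between t_i and t_{i+1}. A monotone step map equal to t_i on (t_i, b_i)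
and to s_i on (b_i, t_{i+1}) turns `f` into ∑ f(t_i) 1_{(t_i, b_i)}. For b_i = t_i + ε p_i its
moment against v is about ε ∑ f(t_i) p_i v(t_i).

The Chebyshev property gives a relation ∑ w_i v(t_i) = 0 on `V` in which w_i has the sign of f(t_i)
(`exists_alternating_relation`). Hence the positive widths p_i = w_i / f(t_i) cancel the moments to
first order. Replacing w_i by w_i + z_i for i < n, with z in the unit ball of ℝⁿ, makes the moments
against the basis dual to t_0, ..., t_{n-1} close to ε z (`eventually_moment_pos`).

So the moment map points outwards on the unit sphere. This is stable under smoothing the steps by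
the Poisson kernel (`continuousAt_integral_stepLift`), which yields genuine diffeomorphisms.
Brouwer's theorem (`exists_zero_of_inner_pos`) then gives a z for which all moments vanish exactly.
-/

open MeasureTheory Set Filter Topology

/-! ### Brouwer's theorem, by the change of variables formula. -/

/-- `det (1 + t A)` is a polynomial in `t` of degree at most the dimension, so its value at `1` is
a fixed affine combination of its values at sufficiently many nodes. -/
theorem exists_det_one_add_eq_sum (E : Type*) [NormedAddCommGroup E] [NormedSpace ℝ E]
    [FiniteDimensional ℝ E] (τ : ℕ → ℝ) (hτ : Function.Injective τ) :
    ∃ a : ℕ → ℝ, ∑ k ∈ Finset.range (Module.finrank ℝ E + 1), a k = 1 ∧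
      ∀ A : E →L[ℝ] E, (1 + A).det =
        ∑ k ∈ Finset.range (Module.finrank ℝ E + 1), a k * (1 + τ k • A).det := by
  classical
  set s := Finset.range (Module.finrank ℝ E + 1)
  refine ⟨fun k => (Lagrange.basis s τ k).eval 1, ?_, fun A => ?_⟩
  · rw [← Polynomial.eval_finsetSum, Lagrange.sum_basis hτ.injOn (by simp [s]), Polynomial.eval_one]
  · let b := Module.finBasis ℝ E
    let M := LinearMap.toMatrix b b (A : E →ₗ[ℝ] E)
    let p : Polynomial ℝ :=
      ((Polynomial.X : Polynomial ℝ) • M.map Polynomial.C +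
        (1 : Matrix (Fin (Module.finrank ℝ E)) (Fin (Module.finrank ℝ E)) ℝ).map Polynomial.C).det
    have hp : ∀ t : ℝ, p.eval t = (1 + t • A).det := by
      intro t
      have h1 : (1 + t • A).det = LinearMap.det (LinearMap.id + t • (A : E →ₗ[ℝ] E)) := rfl
      rw [h1, ← LinearMap.det_toMatrix b, map_add, map_smul, LinearMap.toMatrix_id]
      simp only [p]
      rw [← Polynomial.coe_evalRingHom, RingHom.map_det]
      congr 1
      ext i j
      simp [M, Matrix.one_apply, apply_ite, add_comm]
      exact mul_comm _ _
    have hdeg : p.degree < (s.card : WithBot ℕ) := by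
      refine lt_of_le_of_lt Polynomial.degree_le_natDegree ?_
      have := Polynomial.natDegree_det_X_add_C_le M 1
      rw [Fintype.card_fin] at this
      simp only [s, Finset.card_range]
      exact_mod_cast Nat.lt_succ_of_le this
    have h := congrArg (Polynomial.eval 1) (Lagrange.eq_interpolate hτ.injOn hdeg)
    rw [hp, Lagrange.interpolate_apply, Polynomial.eval_finsetSum] at h
    simp only [one_smul, Polynomial.eval_mul, Polynomial.eval_C, hp] at h
    rw [h]
    exact Finset.sum_congr rfl fun k _ => mul_comm _ _

theorem LipschitzWith.bijective_id_add {E : Type*} [NormedAddCommGroup E] [NormedSpace ℝ E]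
    [CompleteSpace E] {U : E → E} {c : NNReal} (hU : LipschitzWith c U) (hc : c < 1) :
    Function.Bijective fun x => x + U x := by
  have happ : ApproximatesLinearOn (fun x => x + U x)
      ((ContinuousLinearEquiv.refl ℝ E : E ≃L[ℝ] E) : E →L[ℝ] E) univ c := by
    rw [ApproximatesLinearOn.approximatesLinearOn_iff_lipschitzOnWith, lipschitzOnWith_univ]
    convert hU using 1
    ext x
    simp
  have hc' : Subsingleton E ∨
      c < ‖((ContinuousLinearEquiv.refl ℝ E).symm : E →L[ℝ] E)‖₊⁻¹ := by
    rcases subsingleton_or_nontrivial E with h | h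
    · exact Or.inl h
    · right
      have : ((ContinuousLinearEquiv.refl ℝ E).symm : E →L[ℝ] E) = ContinuousLinearMap.id ℝ E := rfl
      rw [this, ContinuousLinearMap.nnnorm_id, inv_one]
      exact hc
  exact ⟨injOn_univ.1 (injOn_iff_injective.2 (happ.injective hc')), happ.surjective hc'⟩

/-- Extension by zero of a Lipschitz function on a ball which vanishes on the sphere. -/
theorem LipschitzOnWith.indicator_closedBall {E F : Type*} [NormedAddCommGroup E] [NormedSpace ℝ E]
    [NormedAddCommGroup F] {u : E → F} {C : NNReal} {R : ℝ}
    (hu : LipschitzOnWith C u (Metric.closedBall 0 R)) (h0 : ∀ x, ‖x‖ = R → u x = 0) :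
    LipschitzWith C ((Metric.closedBall (0 : E) R).indicator u) := by
  have key : ∀ x y : E, ‖x‖ ≤ R → R < ‖y‖ → ‖u x‖ ≤ C * dist x y := by
    intro x y hx hy
    -- The segment from x to y crosses the sphere, where u vanishes, at a point no farther from x
    -- than y is.
    have hcont : ContinuousOn (fun t : ℝ => ‖AffineMap.lineMap x y t‖) (Icc 0 1) := by
      apply Continuous.continuousOn
      exact (AffineMap.lineMap_continuous).norm
    obtain ⟨t, ht, htR⟩ := intermediate_value_Icc (zero_le_one) hcont
      (show R ∈ Icc _ _ by simp [hx, hy.le])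
    have hz := hu.dist_le_mul x (by simpa using hx) (AffineMap.lineMap x y t)
      (by simpa using htR.le)
    rw [h0 _ htR, dist_zero_right, dist_left_lineMap] at hz
    refine hz.trans (mul_le_mul_of_nonneg_left ?_ C.2)
    rw [Real.norm_of_nonneg ht.1]
    exact mul_le_of_le_one_left dist_nonneg ht.2
  refine LipschitzWith.of_dist_le_mul fun x y => ?_
  by_cases hx : ‖x‖ ≤ R <;> by_cases hy : ‖y‖ ≤ R
  · rw [indicator_of_mem (by simpa using hx), indicator_of_mem (by simpa using hy)]
    exact hu.dist_le_mul x (by simpa using hx) y (by simpa using hy)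
  · rw [indicator_of_mem (by simpa using hx), indicator_of_notMem (by simpa using hy),
      dist_zero_right]
    exact key x y hx (not_le.1 hy)
  · rw [indicator_of_notMem (by simpa using hx), indicator_of_mem (by simpa using hy),
      dist_zero_left, dist_comm]
    exact key y x hy (not_le.1 hx)
  · rw [indicator_of_notMem (by simpa using hx), indicator_of_notMem (by simpa using hy)]
    simp only [dist_self]; positivity

/-- There is no smooth retraction of a ball onto its boundary sphere. -/
theorem not_exists_contDiff_retraction {E : Type*} [NormedAddCommGroup E] [InnerProductSpace ℝ E]
    [FiniteDimensional ℝ E] [MeasurableSpace E] [BorelSpace E] {R : ℝ} (hR : 0 < R) {r : E → E}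
    (hr : ContDiff ℝ 1 r) (hnorm : ∀ x, ‖r x‖ = R) (hid : ∀ x, ‖x‖ = R → r x = x) : False := by
  set B := Metric.closedBall (0 : E) R
  set u : E → E := fun x => r x - x
  have hu : ContDiff ℝ 1 u := hr.sub contDiff_id
  obtain ⟨C, hC⟩ := hu.contDiffOn.exists_lipschitzOnWith (s := B) one_ne_zero
    (convex_closedBall 0 R) (isCompact_closedBall 0 R)
  -- Extended by zero, the perturbation x + t U x is a map of the whole space, hence a bijection
  -- once |t| C < 1.
  have hU := hC.indicator_closedBall (fun x hx => by simp [u, hid x hx])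
  set U := B.indicator u
  set D : E → E →L[ℝ] E := fderiv ℝ u
  have hD : Continuous D := hu.continuous_fderiv one_ne_zero
  -- the determinant of the derivative of the retraction vanishes
  have hdet0 : ∀ x, (1 + D x).det = 0 := by
    intro x
    have hrx : HasFDerivAt r (1 + D x) x := by
      have := (hasFDerivAt_id (𝕜 := ℝ) x).add (hu.differentiable one_ne_zero x).hasFDerivAt
      exact this.congr_of_eventuallyEq (Eventually.of_forall fun y => by simp [u])
    by_contra hne
    have hsurj : Function.Surjective (1 + D x : E →L[ℝ] E) := by
      have h := (LinearMap.equivOfDetNeZero ((1 + D x : E →L[ℝ] E) : E →ₗ[ℝ] E) hne).surjective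
      intro y
      obtain ⟨z, hz⟩ := h y
      exact ⟨z, hz⟩
    -- Differentiating the constant ‖r‖² = R² in a direction h that the derivative sends to r x
    -- gives 2R² = 0.
    obtain ⟨h, hh⟩ := hsurj (r x)
    have h1 := hrx.norm_sq
    have h2 : (fun y => ‖r y‖ ^ 2) = fun _ => R ^ 2 := by ext y; rw [hnorm]
    rw [h2] at h1
    have h3 := congrArg (fun L : E →L[ℝ] ℝ => L h) (h1.unique (hasFDerivAt_const (R ^ 2) x))
    simp only [smul_apply, ContinuousLinearMap.comp_apply, innerSL_apply_apply,
      hh, real_inner_self_eq_norm_sq, hnorm, zero_apply] at h3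
    simp at h3
    exact hR.ne' h3
  -- for small `t` the map `x + t u x` preserves the volume of the ball
  have hpos : ∀ᶠ t : ℝ in 𝓝 0, ∀ x ∈ B, 0 < (1 + t • D x).det := by
    apply (isCompact_closedBall (0 : E) R).eventually_forall_of_forall_eventually
    intro x _
    have hc : Continuous fun z : ℝ × E => (1 + z.1 • D z.2).det :=
      ContinuousLinearMap.continuous_det.comp
        (continuous_const.add (continuous_fst.smul (hD.comp continuous_snd)))
    apply hc.continuousAt.eventually (lt_mem_nhds _)
    simp [ContinuousLinearMap.det]
  have hsmall : ∀ᶠ t : ℝ in 𝓝 0, |t| * C < 1 := by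
    have : Continuous fun t : ℝ => |t| * (C : ℝ) := by fun_prop
    apply this.continuousAt.eventually (gt_mem_nhds _)
    simp
  have hint : ∀ᶠ t : ℝ in 𝓝 0, ∫ x in B, (1 + t • D x).det = volume.real B := by
    filter_upwards [hpos, hsmall] with t htp hts
    have hbij : Function.Bijective fun x => x + (t • U) x := by
      refine LipschitzWith.bijective_id_add (c := ‖t‖₊ * C) (LipschitzWith.of_dist_le_mul ?_) ?_
      · intro x y
        simp only [Pi.smul_apply, dist_smul₀, NNReal.coe_mul, coe_nnnorm, mul_assoc]
        exact mul_le_mul_of_nonneg_left (hU.dist_le_mul x y) (norm_nonneg _)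
      · rw [← NNReal.coe_lt_coe]
        simpa using hts
    have hout : ∀ x, x ∉ B → x + (t • U) x = x := by
      intro x hx
      simp [U, indicator_of_notMem hx]
    -- A bijection of the space that fixes every point off B permutes B.
    have himage : (fun x => x + (t • U) x) '' B = B := by
      ext y
      constructor
      · rintro ⟨x, hx, rfl⟩
        by_contra hy
        have := hbij.1 (hout _ hy)
        simp only at this hy
        rw [this] at hy
        exact hy hx
      · intro hy
        obtain ⟨x, hx⟩ := hbij.2 y
        refine ⟨x, ?_, hx⟩
        by_contra hxB
        simp only [hout x hxB] at hx
        exact hxB (hx ▸ hy)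
    have heq : ∀ x ∈ B, x + (t • U) x = x + t • u x := by
      intro x hx
      simp [U, indicator_of_mem hx]
    have hderiv : ∀ x ∈ B, HasFDerivWithinAt (fun x => x + (t • U) x) (1 + t • D x) B x := by
      intro x hx
      refine HasFDerivWithinAt.congr ?_ heq (heq x hx)
      exact ((hasFDerivAt_id (𝕜 := ℝ) x).add
        ((hu.differentiable one_ne_zero x).hasFDerivAt.const_smul t)).hasFDerivWithinAt
    have := integral_image_eq_integral_abs_det_fderiv_smul volume
      Metric.isClosed_closedBall.measurableSet hderiv hbij.1.injOn (fun _ => (1 : ℝ))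
    rw [himage] at this
    simp only [smul_eq_mul, mul_one, integral_const, MeasurableSet.univ, measureReal_restrict_apply,
      univ_inter] at this
    rw [this]
    refine setIntegral_congr_fun Metric.isClosed_closedBall.measurableSet fun x hx => ?_
    exact (abs_of_pos (htp x hx)).symm
  obtain ⟨δ, hδ, hball⟩ := Metric.eventually_nhds_iff.1 hint
  -- Distinct nodes strictly inside (0, δ). The integral of the determinant is the volume of B at
  -- each of them, so interpolation gives the same value at t = 1, where the determinant is zero.
  set τ : ℕ → ℝ := fun k => δ / (k + 2)
  have hτ : Function.Injective τ := by
    intro i j hij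
    simp only [τ] at hij
    have hi : (0 : ℝ) < i + 2 := by positivity
    have hj : (0 : ℝ) < j + 2 := by positivity
    rw [div_eq_div_iff hi.ne' hj.ne'] at hij
    have := mul_left_cancel₀ hδ.ne' hij
    exact_mod_cast (add_right_cancel this).symm
  obtain ⟨a, ha, hA⟩ := exists_det_one_add_eq_sum E τ hτ
  have h0 : ∫ x in B, (1 + D x).det = 0 := by simp only [hdet0, integral_zero]
  have hV : ∫ x in B, (1 + D x).det = volume.real B := by
    rw [funext fun x => hA (D x)]
    rw [integral_finsetSum]
    · simp_rw [integral_const_mul]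
      rw [Finset.sum_congr rfl fun k _ => by
        rw [hball (y := τ k) (by
          rw [Real.dist_eq, sub_zero, abs_of_pos (by positivity)]
          exact div_lt_self hδ (by have : (0 : ℝ) ≤ k := by positivity
                                   linarith))], ← Finset.sum_mul, ha, one_mul]
    · intro k _
      have hDk : Continuous fun x => τ k • D x := (continuous_const_smul (τ k)).comp hD
      refine (Continuous.continuousOn ?_).integrableOn_compact (isCompact_closedBall 0 R)
      exact continuous_const.mul (ContinuousLinearMap.continuous_det.comp
        (continuous_const.add hDk))
  have : 0 < volume.real B :=
    ENNReal.toReal_pos (Metric.measure_closedBall_pos volume 0 hR).ne'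
      (isCompact_closedBall 0 R).measure_lt_top.ne
  linarith

/-- Radial normalisation of `G` would be a smooth retraction onto the sphere. -/
theorem not_exists_contDiff_ne_zero {E : Type*} [NormedAddCommGroup E] [InnerProductSpace ℝ E]
    [FiniteDimensional ℝ E] [MeasurableSpace E] [BorelSpace E] {R : ℝ} (hR : 0 < R) {G : E → E}
    (hG : ContDiff ℝ 1 G) (hne : ∀ x, G x ≠ 0) (hid : ∀ x, ‖x‖ = R → G x = x) : False := by
  refine not_exists_contDiff_retraction hR (r := fun x => (R * ‖G x‖⁻¹) • G x) ?_ ?_ ?_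
  · exact (contDiff_const.mul ((hG.norm ℝ hne).inv fun x => norm_ne_zero_iff.2 (hne x))).smul hG
  · intro x
    rw [norm_smul, norm_mul, norm_inv, norm_norm, Real.norm_of_nonneg hR.le, mul_assoc,
      inv_mul_cancel₀ (norm_ne_zero_iff.2 (hne x)), mul_one]
  · intro x hx
    simp only [hid x hx, hx]
    rw [mul_inv_cancel₀ hR.ne', one_smul]

/-- Reduces to the smooth case: the compactly supported G - id is approximated smoothly and then cut
off, so that the result is exactly the identity on the sphere of radius R + 1. -/
theorem not_exists_continuous_ne_zero {E : Type*} [NormedAddCommGroup E] [InnerProductSpace ℝ E]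
    [FiniteDimensional ℝ E] [MeasurableSpace E] [BorelSpace E] {R : ℝ} (hR : 0 < R) {G : E → E}
    (hG : Continuous G) (hne : ∀ x, G x ≠ 0) (hid : ∀ x, R ≤ ‖x‖ → G x = x) : False := by
  obtain ⟨x₀, -, hx₀⟩ := (isCompact_closedBall (0 : E) R).exists_isMinOn
    ⟨0, by simpa using hR.le⟩ hG.norm.continuousOn
  -- An error below min ‖G‖ prevents zeros in the ball; an error below R prevents them outside,
  -- where the approximation of G - id = 0 is shorter than x.
  set m := min ‖G x₀‖ R
  have hm : 0 < m := lt_min (norm_pos_iff.2 (hne x₀)) hR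
  have hsupp : HasCompactSupport fun x => G x - x := by
    refine HasCompactSupport.intro (isCompact_closedBall (0 : E) R) fun x hx => ?_
    rw [hid x (by simpa using (not_le.1 (by simpa using hx)).le), sub_self]
  obtain ⟨g, hg, hgG⟩ := (hsupp.uniformContinuous_of_continuous
    (hG.sub continuous_id)).exists_contDiff_dist_le hm
  let χ : ContDiffBump (0 : E) := ⟨R, R + 1, hR, by linarith⟩
  refine not_exists_contDiff_ne_zero (R := R + 1) (by linarith) (G := fun x => x + χ x • g x)
    ?_ ?_ ?_
  · exact contDiff_id.add (χ.contDiff.smul (hg.of_le (by exact_mod_cast le_top)))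
  · intro x hx
    have hd := hgG x
    rw [dist_eq_norm] at hd
    rcases le_total ‖x‖ R with h | h
    · rw [χ.one_of_mem_closedBall (by simpa using h), one_smul] at hx
      have h1 : ‖G x₀‖ ≤ ‖G x‖ := hx₀ (by simpa using h)
      have h2 : g x - (G x - x) = - G x := by
        rw [eq_neg_of_add_eq_zero_right hx]; abel
      rw [h2, norm_neg] at hd
      exact absurd hd (not_lt.2 ((min_le_left _ _).trans h1))
    · rw [hid x h, sub_self, sub_zero] at hd
      have h1 : ‖x‖ = ‖χ x • g x‖ := 
        (congrArg norm (eq_neg_of_add_eq_zero_left hx)).trans (norm_neg _)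
      rw [norm_smul, Real.norm_of_nonneg χ.nonneg] at h1
      have h2 : χ x * ‖g x‖ ≤ ‖g x‖ := mul_le_of_le_one_left (norm_nonneg _) χ.le_one
      have := min_le_right ‖G x₀‖ R
      linarith
  · intro x hx
    rw [χ.zero_of_le_dist (by simp [χ, hx]), zero_smul, add_zero]

/-- A form of **Brouwer's theorem**: a continuous vector field which points outwards along the unit
sphere has a zero in the unit ball. -/
theorem exists_zero_of_inner_pos {E : Type*} [NormedAddCommGroup E] [InnerProductSpace ℝ E]
    [FiniteDimensional ℝ E] [MeasurableSpace E] [BorelSpace E] {F : E → E} (hF : Continuous F)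
    (hpos : ∀ x, ‖x‖ = 1 → 0 < inner ℝ (F x) x) : ∃ x, ‖x‖ ≤ 1 ∧ F x = 0 := by
  by_contra! hne
  -- `q` projects radially to the unit ball and `s` rises from 0 to 1 between radii 1 and 2. In that
  -- shell the field interpolates between `F (q x)` and x, both having positive inner product with
  -- `q x`.
  let q : E → E := fun x => (max 1 ‖x‖)⁻¹ • x
  let s : E → ℝ := fun x => min 1 (max 0 (‖x‖ - 1))
  have hmax : ∀ x : E, max 1 ‖x‖ ≠ 0 := fun x => (lt_max_of_lt_left one_pos).ne'
  have hq : Continuous q :=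
    ((continuous_const.max continuous_norm).inv₀ hmax).smul continuous_id
  have hs : Continuous s := by fun_prop
  refine not_exists_continuous_ne_zero (R := 2) two_pos
    (G := fun x => (1 - s x) • F (q x) + s x • x) ?_ ?_ ?_
  · exact ((continuous_const.sub hs).smul (hF.comp hq)).add (hs.smul continuous_id)
  · intro x hx
    rcases le_or_gt ‖x‖ 1 with h | h
    · have h1 : s x = 0 := by simp [s, h]
      have h2 : q x = x := by simp [q, h]
      rw [h1, h2] at hx
      exact hne x h (by simpa using hx)
    · have h0 : 0 < ‖x‖ := one_pos.trans h
      have h2 : q x = ‖x‖⁻¹ • x := by simp [q, h.le]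
      have h3 : ‖q x‖ = 1 := by
        rw [h2, norm_smul, norm_inv, norm_norm, inv_mul_cancel₀ h0.ne']
      have h4 := hpos _ h3
      have h5 : 0 < s x := lt_min one_pos (lt_max_of_lt_right (by linarith))
      have h6 : s x ≤ 1 := min_le_left _ _
      have h7 := congrArg (fun y => inner ℝ y (q x)) hx
      simp only [inner_add_left, real_inner_smul_left, inner_zero_left] at h7
      have h8 : 0 < inner ℝ x (q x) := by
        rw [h2, real_inner_smul_right, real_inner_self_eq_norm_sq]
        positivity
      have := mul_nonneg (sub_nonneg.2 h6) h4.le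
      have := mul_pos h5 h8
      linarith
  · intro x hx
    have h1 : s x = 1 := by
      simp only [s]
      rw [max_eq_right (by linarith), min_eq_left (by linarith)]
    simp [h1]

/-! ### Interpolation and alternating relations in Chebyshev systems. -/

namespace IsChebyshevSystem

variable {n : ℕ} {V : Submodule ℝ C(S1, ℝ)}

theorem eq_zero_of_forall_eq_zero (hV : IsChebyshevSystem n V) {a : ℝ} {g : Fin n → ℝ}
    (hg : Function.Injective g) (hga : ∀ k, g k ∈ Ico a (a + 2 * π)) {v : C(S1, ℝ)} (hv : v ∈ V)
    (h0 : ∀ k, v (g k : S1) = 0) : v = 0 := by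
  have : Fact (0 < 2 * π) := ⟨Real.two_pi_pos⟩
  by_contra hne
  have h := hV.zeros_le v hv hne
  have hinj : Function.Injective fun k => (g k : S1) := fun i j hij =>
    hg ((AddCircle.coe_eq_coe_iff_of_mem_Ico (hga i) (hga j)).1 hij)
  have hsub : range (fun k => (g k : S1)) ⊆ {x : S1 | v x = 0} := by
    rintro _ ⟨k, rfl⟩
    exact h0 k
  have hcard : (range fun k => (g k : S1)).encard = n := by
    rw [← image_univ, hinj.encard_image, encard_univ, ENat.card_eq_coe_fintype_card,
      Fintype.card_fin]
  have h2 := (encard_le_encard hsub).trans h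
  rw [hcard] at h2
  have h3 : n ≤ n - 1 := by exact_mod_cast h2
  have := hV.odd.pos
  omega

theorem exists_forall_eq (hV : IsChebyshevSystem n V) {a : ℝ} {g : Fin n → ℝ}
    (hg : Function.Injective g) (hga : ∀ k, g k ∈ Ico a (a + 2 * π)) (y : Fin n → ℝ) :
    ∃ v ∈ V, ∀ k, v (g k : S1) = y k := by
  have : FiniteDimensional ℝ V :=
    Module.finite_of_finrank_pos (by rw [hV.finrank_eq]; exact hV.odd.pos)
  let T : V →ₗ[ℝ] (Fin n → ℝ) :=
    { toFun := fun v k => (v : C(S1, ℝ)) (g k : S1)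
      map_add' := fun _ _ => rfl
      map_smul' := fun _ _ => rfl }
  have hT : Function.Injective T := by
    rw [← LinearMap.ker_eq_bot, LinearMap.ker_eq_bot']
    intro v hv
    exact Subtype.ext (hV.eq_zero_of_forall_eq_zero hg hga v.2 fun k => congrFun hv k)
  have hs : Function.Surjective T :=
    (LinearMap.injective_iff_surjective_of_finrank_eq_finrank
      (by rw [hV.finrank_eq, Module.finrank_fin_fun])).1 hT
  obtain ⟨v, hv⟩ := hs y
  exact ⟨v, v.2, fun k => congrFun hv k⟩

/-- An element of a Chebyshev system vanishing at all but two consecutive of `n + 1` points takes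
values of the same sign at these two. -/
theorem exists_eq_zero_of_ne (hV : IsChebyshevSystem n V) {t : Fin (n + 1) → ℝ}
    (ht : StrictMono t) (htn : t (Fin.last n) < t 0 + 2 * π) (i : Fin n) :
    ∃ v ∈ V, v (t i.castSucc : S1) = 1 ∧ 0 < v (t i.succ : S1) ∧
      ∀ k, k ≠ i.castSucc → k ≠ i.succ → v (t k : S1) = 0 := by
  have hmem : ∀ k, t k ∈ Ico (t 0) (t 0 + 2 * π) := fun k =>
    ⟨ht.monotone (Fin.zero_le k), (ht.monotone (Fin.le_last k)).trans_lt htn⟩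
  obtain ⟨v, hv, hvk⟩ := hV.exists_forall_eq (g := t ∘ i.succ.succAbove)
    (ht.injective.comp Fin.succAbove_right_injective) (fun k => hmem _)
    (fun k => if i.succ.succAbove k = i.castSucc then 1 else 0)
  have hval : ∀ k, k ≠ i.succ → v (t k : S1) = if k = i.castSucc then 1 else 0 := by
    intro k hk
    obtain ⟨j, rfl⟩ := Fin.exists_succAbove_eq hk
    exact hvk j
  have hlt : t i.castSucc < t i.succ := ht Fin.castSucc_lt_succ
  have h1 : v (t i.castSucc : S1) = 1 := by
    rw [hval _ Fin.castSucc_lt_succ.ne, if_pos rfl]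
  refine ⟨v, hv, h1, ?_, fun k hk hk' => by rw [hval k hk', if_neg hk]⟩
  -- A nonpositive value at t_{i+1} forces a zero in (t_i, t_{i+1}]; with the n - 1 prescribed zeros
  -- this makes n, too many.
  by_contra hneg
  have hcont : ContinuousOn (fun x : ℝ => v (x : S1)) (Icc (t i.castSucc) (t i.succ)) :=
    (v.continuous.comp (AddCircle.continuous_mk' _)).continuousOn
  obtain ⟨z, hz, hz0⟩ := intermediate_value_Icc' hlt.le hcont
    (show (0 : ℝ) ∈ Icc _ _ from ⟨not_lt.1 hneg, by simp [h1]⟩)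
  simp only at hz0
  have hzi : t i.castSucc < z := by
    refine lt_of_le_of_ne hz.1 fun h => ?_
    rw [← h, h1] at hz0
    exact one_ne_zero hz0
  have htz : ∀ k, k ≠ i.succ → t k ≠ z := by
    intro k hk h
    rcases lt_or_gt_of_ne hk with hk' | hk'
    · exact absurd (ht.monotone (Fin.le_castSucc_iff.2 hk')) (not_le.2 (h ▸ hzi))
    · exact absurd (ht hk') (not_lt.2 (h ▸ hz.2))
  have hzero := hV.eq_zero_of_forall_eq_zero (a := t 0)
    (g := fun k => if i.succ.succAbove k = i.castSucc then z else t (i.succ.succAbove k))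
    ?_ ?_ hv ?_
  · rw [hzero] at h1
    exact zero_ne_one h1
  · intro k l hkl
    apply Fin.succAbove_right_injective (p := i.succ)
    simp only at hkl
    split_ifs at hkl with hk hl hl
    · rw [hk, hl]
    · exact absurd hkl.symm (htz _ (Fin.succAbove_ne _ _))
    · exact absurd hkl (htz _ (Fin.succAbove_ne _ _))
    · exact ht.injective hkl
  · intro k
    split_ifs
    · exact ⟨(hmem i.castSucc).1.trans hz.1, hz.2.trans_lt (hmem i.succ).2⟩
    · exact hmem _
  · intro k
    split_ifs with hk
    · exact hz0
    · rw [hval _ (Fin.succAbove_ne _ _), if_neg hk]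

/-- The evaluations at `n + 1` consecutive points satisfy a linear relation whose coefficients
alternate in sign. -/
theorem exists_alternating_relation (hV : IsChebyshevSystem n V) {t : Fin (n + 1) → ℝ}
    (ht : StrictMono t) (htn : t (Fin.last n) < t 0 + 2 * π) {c : Fin (n + 1) → ℝ}
    (hc : ∀ i : Fin n, c i.castSucc * c i.succ < 0) :
    ∃ w : Fin (n + 1) → ℝ, (∀ i, 0 < w i * c i) ∧
      ∀ v ∈ V, ∑ i, w i * v (t i : S1) = 0 := by
  have hmem : ∀ k, t k ∈ Ico (t 0) (t 0 + 2 * π) := fun k =>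
    ⟨ht.monotone (Fin.zero_le k), (ht.monotone (Fin.le_last k)).trans_lt htn⟩
  have hinj : Function.Injective fun k : Fin n => t k.castSucc :=
    ht.injective.comp (Fin.castSucc_injective n)
  choose e he hek using fun j : Fin n => hV.exists_forall_eq hinj (fun k => hmem _)
    (fun k => if k = j then 1 else 0)
  -- Lagrange interpolation at the first n points, evaluated at the last one, is the desired
  -- relation.
  let w : Fin (n + 1) → ℝ := Fin.snoc (fun j => - e j (t (Fin.last n) : S1)) 1
  have hw : ∀ v ∈ V, ∑ i, w i * v (t i : S1) = 0 := by
    intro v hv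
    have h : v - ∑ j, v (t j.castSucc : S1) • e j = 0 := by
      refine hV.eq_zero_of_forall_eq_zero hinj (fun k => hmem _)
        (V.sub_mem hv (V.sum_mem fun j _ => V.smul_mem _ (he j))) fun k => ?_
      simp [ContinuousMap.sum_apply, hek]
    have h2 := DFunLike.congr_fun h (t (Fin.last n) : S1)
    simp only [ContinuousMap.sub_apply, ContinuousMap.sum_apply, ContinuousMap.smul_apply,
      smul_eq_mul, ContinuousMap.zero_apply] at h2
    rw [Fin.sum_univ_castSucc]
    simp only [w, Fin.snoc_castSucc, Fin.snoc_last, one_mul, neg_mul, Finset.sum_neg_distrib]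
    simp only [mul_comm] at h2 ⊢
    linarith
  have hstep : ∀ i : Fin n, w i.succ ≠ 0 → w i.castSucc * w i.succ < 0 := by
    intro i hi
    -- On this v the relation reduces to w_i + w_{i+1} v(t_{i+1}) = 0 with v(t_{i+1}) > 0.
    obtain ⟨v, hv, h1, hpos, h0⟩ := hV.exists_eq_zero_of_ne ht htn i
    have h := hw v hv
    rw [Finset.sum_eq_add i.castSucc i.succ Fin.castSucc_lt_succ.ne
      (fun k _ hk => by rw [h0 k hk.1 hk.2, mul_zero]) (by simp) (by simp), h1, mul_one] at h
    rw [eq_neg_of_add_eq_zero_left h]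
    have := mul_pos (sq_pos_of_ne_zero hi) hpos
    nlinarith
  have hne : ∀ i, w i ≠ 0 := by
    intro i
    induction i using Fin.reverseInduction with
    | last => simp [w]
    | cast i ih => exact left_ne_zero_of_mul (hstep i ih).ne
  have hsame : ∀ i, 0 < (w 0 * c 0) * (w i * c i) := by
    have hc0 : c 0 ≠ 0 := by
      have := left_ne_zero_of_mul (hc ⟨0, hV.odd.pos⟩).ne
      exact this
    intro i
    induction i using Fin.induction with
    | zero => exact mul_self_pos.2 (mul_ne_zero (hne 0) hc0)
    | succ i ih =>
      have h := mul_pos_of_neg_of_neg (hstep i (hne _)) (hc i)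
      have h2 : 0 < ((w 0 * c 0) * (w i.succ * c i.succ)) * (w i.castSucc * c i.castSucc) ^ 2 := by
        have := mul_pos ih h
        nlinarith
      exact pos_of_mul_pos_left h2 (sq_nonneg _)
  -- Both sequences alternate, so their signs agree up to one global sign, which the factor `w 0 * c
  -- 0` corrects.
  refine ⟨fun i => (w 0 * c 0) * w i, fun i => by rw [mul_assoc]; exact hsame i, fun v hv => ?_⟩
  simp only [mul_assoc, ← Finset.mul_sum, hw v hv, mul_zero]

end IsChebyshevSystem

/-! ### Step functions smoothed by the Poisson kernel. -/

/-- A smooth approximation, as `r → 1⁻`, of the quasi-periodic step function which equals `0` on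
`(-2π, 0)` and `1` on `(0, 2π)`: a primitive of the Poisson kernel. -/
noncomputable def poissonStep (r u : ℝ) : ℝ :=
  u / (2 * π) + 1 / 2 + Real.arctan (r * Real.sin u / (1 - r * Real.cos u)) / π

theorem mul_cos_lt_one {r u : ℝ} (hr0 : 0 < r) (hr1 : r ≤ 1) (h : r < 1 ∨ Real.cos u ≠ 1) :
    r * Real.cos u < 1 := by
  have hc := Real.cos_le_one u
  rcases h with h | h
  · nlinarith
  · have := lt_of_le_of_ne hc h
    nlinarith

theorem poissonStep_add_two_pi (r u : ℝ) : poissonStep r (u + 2 * π) = poissonStep r u + 1 := by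
  have := Real.pi_pos
  simp only [poissonStep, Real.sin_add_two_pi, Real.cos_add_two_pi]
  field_simp
  ring

theorem contDiff_poissonStep {r : ℝ} (hr0 : 0 < r) (hr1 : r < 1) : ContDiff ℝ ∞ (poissonStep r) := by
  have h : ∀ u, 1 - r * Real.cos u ≠ 0 := fun u =>
    (sub_pos.2 (mul_cos_lt_one hr0 hr1.le (Or.inl hr1))).ne'
  unfold poissonStep
  exact ((contDiff_id.div_const _).add contDiff_const).add
    ((Real.contDiff_arctan.comp ((contDiff_const.mul Real.contDiff_sin).div
      (contDiff_const.sub (contDiff_const.mul Real.contDiff_cos)) h)).div_const _)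

/-- The derivative is the Poisson kernel (1 - r²) / (2π (1 - 2r cos u + r²)). -/
theorem deriv_poissonStep_pos {r : ℝ} (hr0 : 0 < r) (hr1 : r < 1) (u : ℝ) :
    0 < deriv (poissonStep r) u := by
  have h : 0 < 1 - r * Real.cos u := sub_pos.2 (mul_cos_lt_one hr0 hr1.le (Or.inl hr1))
  have h1 : HasDerivAt (fun u => r * Real.sin u) (r * Real.cos u) u :=
    (Real.hasDerivAt_sin u).const_mul r
  have h2 : HasDerivAt (fun u => 1 - r * Real.cos u) (- (r * (- Real.sin u))) u :=
    ((Real.hasDerivAt_cos u).const_mul r).const_sub 1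
  have h3 : HasDerivAt (poissonStep r) _ u :=
    (((hasDerivAt_id u).div_const (2 * π)).add_const (1 / 2)).add
      ((h1.div h2 h.ne').arctan.div_const π)
  rw [h3.deriv]
  have hpi := Real.pi_pos
  have hsq : Real.sin u ^ 2 = 1 - Real.cos u ^ 2 := Real.sin_sq u
  have hd : 0 < 1 - 2 * r * Real.cos u + r ^ 2 := by
    have := Real.cos_le_one u
    nlinarith [mul_pos hr0 hr0, sq_pos_of_pos (sub_pos.2 hr1)]
  have hq : 1 + (r * Real.sin u / (1 - r * Real.cos u)) ^ 2
      = (1 - 2 * r * Real.cos u + r ^ 2) / (1 - r * Real.cos u) ^ 2 := by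
    field_simp
    rw [hsq]; ring
  have hn : r * Real.cos u * (1 - r * Real.cos u) - r * Real.sin u * -(r * -Real.sin u)
      = r * Real.cos u - r ^ 2 := by
    linear_combination (- r ^ 2) * hsq
  have : 1 / (2 * π) + 1 / (1 + ((fun u => r * Real.sin u) u / (1 - r * Real.cos u)) ^ 2) *
      ((r * Real.cos u * (1 - r * Real.cos u) - r * Real.sin u * -(r * -Real.sin u)) /
        (1 - r * Real.cos u) ^ 2) / π
      = (1 - r ^ 2) / (2 * π * (1 - 2 * r * Real.cos u + r ^ 2)) := by
    rw [hn, hq]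
    field_simp
    ring
  refine lt_of_lt_of_eq ?_ this.symm
  have : 0 < 1 - r ^ 2 := by nlinarith
  positivity

/-- For r = 1 the argument of the arctangent is cot(u/2) = tan(π/2 - u/2), so the arctangent cancels
the linear term. -/
theorem poissonStep_one_of_pos {u : ℝ} (h0 : 0 < u) (h1 : u < 2 * π) : poissonStep 1 u = 1 := by
  have hpi := Real.pi_pos
  have hs : 0 < Real.sin (u / 2) := Real.sin_pos_of_pos_of_lt_pi (by linarith) (by linarith)
  have h : 1 * Real.sin u / (1 - 1 * Real.cos u) = Real.tan (π / 2 - u / 2) := by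
    rw [Real.tan_pi_div_two_sub, Real.tan_eq_sin_div_cos, inv_div]
    have hu : u = 2 * (u / 2) := by ring
    have h2 : 1 - Real.cos u = 2 * Real.sin (u / 2) ^ 2 := by
      conv_lhs => rw [hu]
      rw [Real.cos_two_mul, Real.cos_sq']; ring
    have h3 : Real.sin u = 2 * Real.sin (u / 2) * Real.cos (u / 2) := by
      conv_lhs => rw [hu]
      rw [Real.sin_two_mul]
    rw [one_mul, one_mul, h2, h3]
    field_simp
  rw [poissonStep, h, Real.arctan_tan (by linarith) (by linarith)]
  field_simp
  ring

theorem poissonStep_one_of_neg {u : ℝ} (h0 : u < 0) (h1 : -(2 * π) < u) : poissonStep 1 u = 0 := by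
  have h := poissonStep_add_two_pi 1 u
  rw [poissonStep_one_of_pos (by linarith) (by linarith)] at h
  linarith

theorem ContinuousAt.poissonStep {X : Type*} [TopologicalSpace X] {r u : X → ℝ} {x : X}
    (hr : ContinuousAt r x) (hu : ContinuousAt u x) (h : r x * Real.cos (u x) < 1) :
    ContinuousAt (fun y => _root_.poissonStep (r y) (u y)) x := by
  unfold _root_.poissonStep
  refine ((hu.div_const _).add continuousAt_const).add (ContinuousAt.div_const ?_ _)
  refine Real.continuous_arctan.continuousAt.comp ?_
  exact (hr.mul (Real.continuous_sin.continuousAt.comp hu)).div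
    (continuousAt_const.sub (hr.mul (Real.continuous_cos.continuousAt.comp hu)))
    (sub_pos.2 h).ne'

theorem measurable_poissonStep (r : ℝ) : Measurable (poissonStep r) := by
  unfold poissonStep
  have := Real.measurable_arctan
  fun_prop

/-! ### The smoothed step map, its limit at r = 1 and its moments. -/

/-- A smoothed version of the step function with value `t i` between `t i` and `b i` and value `s i`
between `b i` and `t (i + 1)`, for `i ≤ n`. -/
noncomputable def stepLift (n : ℕ) (t s b : ℕ → ℝ) (r x : ℝ) : ℝ :=
  t 0 + ∑ i ∈ Finset.range (n + 1), ((s i - t i) * poissonStep r (x - b i) +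
    (t (i + 1) - s i) * poissonStep r (x - t (i + 1)))

section stepLift

variable {n : ℕ} {t s b : ℕ → ℝ} {r : ℝ}

theorem measurable_stepLift (n : ℕ) (t s b : ℕ → ℝ) (r : ℝ) : Measurable (stepLift n t s b r) := by
  unfold stepLift
  refine measurable_const.add (Finset.measurable_sum _ fun i _ => ?_)
  exact (((measurable_poissonStep r).comp (measurable_id.sub_const _)).const_mul _).add
    (((measurable_poissonStep r).comp (measurable_id.sub_const _)).const_mul _)

theorem contDiff_stepLift (hr0 : 0 < r) (hr1 : r < 1) : ContDiff ℝ ∞ (stepLift n t s b r) := by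
  have h := contDiff_poissonStep hr0 hr1
  unfold stepLift
  refine contDiff_const.add (ContDiff.sum fun i _ => ?_)
  exact (contDiff_const.mul (h.comp (contDiff_id.sub contDiff_const))).add
    (contDiff_const.mul (h.comp (contDiff_id.sub contDiff_const)))

theorem deriv_stepLift_pos (hr0 : 0 < r) (hr1 : r < 1) (hts : ∀ i < n + 1, t i < s i)
    (hst : ∀ i < n + 1, s i < t (i + 1)) (x : ℝ) : 0 < deriv (stepLift n t s b r) x := by
  have hd : ∀ a, HasDerivAt (fun x => poissonStep r (x - a)) (deriv (poissonStep r) (x - a)) x :=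
    fun a => HasDerivAt.comp_sub_const x a
      (((contDiff_poissonStep hr0 hr1).differentiable (by simp)) _).hasDerivAt
  have h : HasDerivAt (stepLift n t s b r) (∑ i ∈ Finset.range (n + 1),
      ((s i - t i) * deriv (poissonStep r) (x - b i) +
        (t (i + 1) - s i) * deriv (poissonStep r) (x - t (i + 1)))) x := by
    unfold stepLift
    refine HasDerivAt.const_add _ (HasDerivAt.fun_sum fun i _ => ?_)
    exact ((hd _).const_mul _).add ((hd _).const_mul _)
  rw [h.deriv]
  refine Finset.sum_pos (fun i hi => ?_) (by simp)
  have hi' := Finset.mem_range.1 hi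
  exact add_pos (mul_pos (sub_pos.2 (hts i hi')) (deriv_poissonStep_pos hr0 hr1 _))
    (mul_pos (sub_pos.2 (hst i hi')) (deriv_poissonStep_pos hr0 hr1 _))

theorem stepLift_add_two_pi (htn : t (n + 1) = t 0 + 2 * π) (x : ℝ) :
    stepLift n t s b r (x + 2 * π) = stepLift n t s b r x + 2 * π := by
  have h : ∀ a, poissonStep r (x + 2 * π - a) = poissonStep r (x - a) + 1 := fun a => by
    rw [← poissonStep_add_two_pi]; ring_nf
  have hsum : ∑ i ∈ Finset.range (n + 1), (t (i + 1) - t i) = 2 * π := by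
    rw [Finset.sum_range_sub, htn]; ring
  simp only [stepLift, h]
  rw [← hsum, add_assoc, ← Finset.sum_add_distrib]
  congr 1
  exact Finset.sum_congr rfl fun i _ => by ring

theorem exists_diffeo_stepLift (hr0 : 0 < r) (hr1 : r < 1) (hts : ∀ i < n + 1, t i < s i)
    (hst : ∀ i < n + 1, s i < t (i + 1)) (htn : t (n + 1) = t 0 + 2 * π) :
    ∃ φ : S1 → S1, IsOrientationPreservingDiffeo φ ∧
      ∀ x : ℝ, φ (x : S1) = (stepLift n t s b r x : S1) := by
  have hper : Function.Periodic (fun x : ℝ => (stepLift n t s b r x : S1)) (2 * π) := fun x => by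
    simp only [stepLift_add_two_pi htn, AddCircle.coe_add_period]
  exact ⟨hper.lift, ⟨_, contDiff_stepLift hr0 hr1, deriv_stepLift_pos hr0 hr1 hts hst,
    stepLift_add_two_pi htn, fun x => hper.lift_coe x⟩, fun x => hper.lift_coe x⟩

/-- The steps before t_m are complete and telescope to t_m - t_0, the later ones have not begun;
only the step at b_m is undecided. All arguments stay within (-2π, 2π) because the points span one
period. -/
theorem stepLift_one_eq (ht : StrictMono t) (htn : t (n + 1) = t 0 + 2 * π)
    (htb : ∀ i < n + 1, t i < b i) (hbt : ∀ i < n + 1, b i < t (i + 1)) {m : ℕ} (hm : m < n + 1)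
    {x : ℝ} (h0 : t m < x) (h1 : x < t (m + 1)) :
    stepLift n t s b 1 x = t m + (s m - t m) * poissonStep 1 (x - b m) := by
  have hm0 : t 0 ≤ t m := ht.monotone m.zero_le
  have hmn : t (m + 1) ≤ t (n + 1) := ht.monotone hm
  have hlow : ∀ i < m, (s i - t i) * poissonStep 1 (x - b i) +
      (t (i + 1) - s i) * poissonStep 1 (x - t (i + 1)) = t (i + 1) - t i := by
    intro i hi
    have hin := hi.trans hm
    have a1 := htb i hin
    have a2 := hbt i hin
    have a3 : t (i + 1) ≤ t m := ht.monotone hi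
    have a4 : t 0 ≤ t i := ht.monotone i.zero_le
    rw [poissonStep_one_of_pos (by linarith) (by linarith),
      poissonStep_one_of_pos (by linarith) (by linarith)]
    ring
  rw [stepLift, ← Finset.sum_subset (Finset.range_mono (Nat.succ_le_of_lt hm)),
    Finset.sum_range_succ, Finset.sum_congr rfl fun i hi => hlow i (Finset.mem_range.1 hi),
    Finset.sum_range_sub, poissonStep_one_of_neg (u := x - t (m + 1)) (by linarith) (by linarith)]
  · ring
  · intro i hi hi'
    have hin := Finset.mem_range.1 hi
    have him : m + 1 ≤ i := by simpa using hi'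
    have a1 := htb i hin
    have a2 := hbt i hin
    have a3 : t (m + 1) ≤ t i := ht.monotone him
    have a4 : t (i + 1) ≤ t (n + 1) := ht.monotone hin
    rw [poissonStep_one_of_neg (by linarith) (by linarith),
      poissonStep_one_of_neg (by linarith) (by linarith)]
    ring

theorem exists_norm_mul_le (f v : C(S1, ℝ)) : ∃ M, ∀ x y : S1, ‖f x * v y‖ ≤ M := by
  have : Fact (0 < 2 * π) := ⟨Real.two_pi_pos⟩
  refine ⟨‖f‖ * ‖v‖, fun x y => ?_⟩
  rw [norm_mul]
  exact mul_le_mul (f.norm_coe_le_norm x) (v.norm_coe_le_norm y) (norm_nonneg _) (norm_nonneg _)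

theorem measurable_stepLift_integrand (f v : C(S1, ℝ)) (n : ℕ) (t s b : ℕ → ℝ) (r : ℝ) :
    Measurable fun x : ℝ => f (stepLift n t s b r x : S1) * v (x : S1) :=
  ((f.continuous.comp (AddCircle.continuous_mk' _)).measurable.comp
    (measurable_stepLift n t s b r)).mul (v.continuous.comp (AddCircle.continuous_mk' _)).measurable

theorem intervalIntegrable_stepLift_integrand (f v : C(S1, ℝ)) (n : ℕ) (t s b : ℕ → ℝ) (r : ℝ)
    (x y : ℝ) :
    IntervalIntegrable (fun x : ℝ => f (stepLift n t s b r x : S1) * v (x : S1)) volume x y := by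
  obtain ⟨M, hM⟩ := exists_norm_mul_le f v
  refine (intervalIntegrable_const (c := M)).mono_fun
    (measurable_stepLift_integrand f v n t s b r).aestronglyMeasurable ?_
  exact Eventually.of_forall fun x => (hM _ _).trans (le_abs_self M)

theorem integral_stepLift_one (f v : C(S1, ℝ)) (ht : StrictMono t)
    (htn : t (n + 1) = t 0 + 2 * π) (htb : ∀ i < n + 1, t i < b i)
    (hbt : ∀ i < n + 1, b i < t (i + 1)) (hs : ∀ i < n + 1, f (s i : S1) = 0) :
    ∫ x in t 0..(t 0 + 2 * π), f (stepLift n t s b 1 x : S1) * v (x : S1) =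
      ∑ i ∈ Finset.range (n + 1), f (t i : S1) * ∫ x in t i..b i, v (x : S1) := by
  rw [← htn, ← intervalIntegral.sum_integral_adjacent_intervals fun k _ =>
    intervalIntegrable_stepLift_integrand f v n t s b 1 _ _]
  refine Finset.sum_congr rfl fun i hi => ?_
  have hi' := Finset.mem_range.1 hi
  have a1 := htb i hi'
  have a2 := hbt i hi'
  have a3 : t 0 ≤ t i := ht.monotone i.zero_le
  have a4 : t (i + 1) ≤ t (n + 1) := ht.monotone hi'
  rw [← intervalIntegral.integral_add_adjacent_intervals
    (intervalIntegrable_stepLift_integrand f v n t s b 1 _ (b i))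
    (intervalIntegrable_stepLift_integrand f v n t s b 1 _ _)]
  have e1 : ∫ x in t i..b i, f (stepLift n t s b 1 x : S1) * v (x : S1) =
      ∫ x in t i..b i, f (t i : S1) * v (x : S1) := by
    rw [intervalIntegral.integral_of_le a1.le, intervalIntegral.integral_of_le a1.le,
      integral_Ioc_eq_integral_Ioo, integral_Ioc_eq_integral_Ioo]
    refine setIntegral_congr_fun measurableSet_Ioo fun x hx => ?_
    rw [stepLift_one_eq ht htn htb hbt hi' hx.1 (hx.2.trans a2),
      poissonStep_one_of_neg (by linarith [hx.2]) (by linarith [hx.1]), mul_zero, add_zero]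
  have e2 : ∫ x in b i..t (i + 1), f (stepLift n t s b 1 x : S1) * v (x : S1) = 0 := by
    rw [intervalIntegral.integral_of_le a2.le, integral_Ioc_eq_integral_Ioo]
    refine setIntegral_eq_zero_of_forall_eq_zero fun x hx => ?_
    rw [stepLift_one_eq ht htn htb hbt hi' (a1.trans hx.1) hx.2,
      poissonStep_one_of_pos (by linarith [hx.1]) (by linarith [hx.2]), mul_one,
      add_sub_cancel, hs i hi', zero_mul]
  rw [e1, e2, add_zero, intervalIntegral.integral_const_mul]

theorem ae_cos_sub_ne_one (a : ℝ) : ∀ᵐ x : ℝ, Real.cos (x - a) ≠ 1 := by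
  have h : {x : ℝ | Real.cos (x - a) = 1} ⊆ range fun k : ℤ => k * (2 * π) + a := by
    intro x hx
    obtain ⟨k, hk⟩ := (Real.cos_eq_one_iff _).1 hx
    exact ⟨k, by simp [hk]⟩
  have := ((countable_range _).mono h).ae_notMem volume
  filter_upwards [this] with x hx using hx

/-- Dominated convergence with a constant bound. The value r = 1 is included, which links the smooth
maps to the step map: there the integrand is continuous in the parameters except for x at a jump
modulo 2π, a null set. -/
theorem continuousAt_integral_stepLift {X : Type*} [TopologicalSpace X] [FirstCountableTopology X]
    (f v : C(S1, ℝ)) (n : ℕ) (t s : ℕ → ℝ) {b : X → ℕ → ℝ} (hb : Continuous b) {r : ℝ} (hr0 : 0 < r)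
    (hr1 : r ≤ 1) (x₀ : X) (y z : ℝ) :
    ContinuousAt (fun q : ℝ × X =>
      ∫ x in y..z, f (stepLift n t s (b q.2) q.1 x : S1) * v (x : S1)) (r, x₀) := by
  obtain ⟨M, hM⟩ := exists_norm_mul_le f v
  refine intervalIntegral.continuousAt_of_dominated_interval (bound := fun _ => M) ?_ ?_
    intervalIntegrable_const ?_
  · exact Eventually.of_forall fun q =>
      (measurable_stepLift_integrand f v n t s _ _).aestronglyMeasurable
  · exact Eventually.of_forall fun q => Eventually.of_forall fun x _ => hM _ _
  · have h1 : ∀ᵐ x : ℝ, ∀ i, Real.cos (x - b x₀ i) ≠ 1 := ae_all_iff.2 fun i => ae_cos_sub_ne_one _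
    have h2 : ∀ᵐ x : ℝ, ∀ i, Real.cos (x - t i) ≠ 1 := ae_all_iff.2 fun i => ae_cos_sub_ne_one _
    filter_upwards [h1, h2] with x hx1 hx2 _
    refine ContinuousAt.mul ?_ continuousAt_const
    refine (f.continuous.comp (AddCircle.continuous_mk' _)).continuousAt.comp (x := (r, x₀))
      (f := fun q : ℝ × X => stepLift n t s (b q.2) q.1 x) ?_
    unfold stepLift
    refine continuousAt_const.add (tendsto_finsetSum _ fun i _ => ?_)
    have hbi : ContinuousAt (fun q : ℝ × X => b q.2 i) (r, x₀) :=
      ((continuous_apply i).comp (hb.comp continuous_snd)).continuousAt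
    have h3 : ContinuousAt (fun q : ℝ × X => poissonStep q.1 (x - b q.2 i)) (r, x₀) :=
      ContinuousAt.poissonStep continuousAt_fst (continuousAt_const.sub hbi)
        (mul_cos_lt_one hr0 hr1 (Or.inr (hx1 i)))
    have h4 : ContinuousAt (fun q : ℝ × X => poissonStep q.1 (x - t (i + 1))) (r, x₀) :=
      ContinuousAt.poissonStep continuousAt_fst continuousAt_const
        (mul_cos_lt_one hr0 hr1 (Or.inr (hx2 (i + 1))))
    exact (h3.const_mul _).add (h4.const_mul _)

end stepLift

/-! ### Cyclic sign pattern, normalised relation and dual basis. -/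

/-- When the number of sign changes is even, the sign-change points can be continued to a strictly
increasing sequence which closes up after one turn, with cyclically alternating signs. -/
theorem HasAtLeastSignChanges.exists_strictMono {f : S1 → ℝ} {n : ℕ} (hn : Odd n)
    (hf : HasAtLeastSignChanges f (n + 1)) :
    ∃ t : ℕ → ℝ, StrictMono t ∧ t (n + 1) = t 0 + 2 * π ∧
      ∀ i < n + 1, f (t i : S1) * f (t (i + 1) : S1) < 0 := by
  obtain ⟨t, ht, htn, hft⟩ := hf
  -- The original last point is dropped in favour of t_0 + 2π, which is the value at k = n + 1;
  -- later values only keep the sequence strictly increasing.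
  let τ : ℕ → ℝ := fun k =>
    if h : k < n + 1 then t ⟨k, by omega⟩ else t 0 + 2 * π + ((k : ℝ) - (n + 1))
  have hτ : ∀ k (h : k < n + 1), τ k = t ⟨k, by omega⟩ := fun k h => dif_pos h
  have hτ0 : τ 0 = t 0 := hτ 0 (by omega)
  have hτn : τ (n + 1) = τ 0 + 2 * π := by
    rw [hτ0]
    simp [τ]
  have hlt : ∀ i < n, f (τ i : S1) * f (τ (i + 1) : S1) < 0 := by
    intro i hi
    rw [hτ i (by omega), hτ (i + 1) (by omega)]
    exact hft ⟨i, by omega⟩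
  have hsign : ∀ i < n + 1, 0 < (-1) ^ i * (f (τ 0 : S1) * f (τ i : S1)) := by
    intro i
    induction i with
    | zero =>
      intro _
      have := left_ne_zero_of_mul (hlt 0 hn.pos).ne
      simpa using mul_self_pos.2 this
    | succ i ih =>
      intro hi
      have h1 := mul_pos_of_neg_of_neg (neg_neg_of_pos (ih (by omega))) (hlt i (by omega))
      have h2 : 0 < ((-1) ^ (i + 1) * (f (τ 0 : S1) * f (τ (i + 1) : S1))) * f (τ i : S1) ^ 2 := by
        rw [pow_succ]
        linarith
      exact pos_of_mul_pos_left h2 (sq_nonneg _)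
  refine ⟨τ, strictMono_nat_of_lt_succ fun k => ?_, hτn, fun i hi => ?_⟩
  · rcases lt_trichotomy k n with h | h | h
    · rw [hτ k (by omega), hτ (k + 1) (by omega)]
      exact ht (by simp [Fin.lt_def])
    · rw [h, hτn, hτ0, hτ n (by omega)]
      exact (ht (by simp [Fin.lt_def])).trans_le htn
    · simp only [τ]
      rw [dif_neg (by omega), dif_neg (by omega)]
      push_cast
      linarith
  · rcases Nat.lt_succ_iff_lt_or_eq.1 hi with h | rfl
    · exact hlt i h
    -- Closing up: after an odd number n of changes the sign at t_n is opposite to that at t_0.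
    · have h1 := hsign i hi
      rw [hn.neg_one_pow] at h1
      rw [hτn, AddCircle.coe_add_period]
      linarith

namespace IsChebyshevSystem

variable {n : ℕ} {V : Submodule ℝ C(S1, ℝ)}

/-- Rescaling to |w_i| > 1 ensures that adding z_i with |z_i| ≤ 1 does not change the sign of w_i.
-/
theorem exists_alternating_relation_one_lt (hV : IsChebyshevSystem n V) {t : ℕ → ℝ}
    (ht : StrictMono t) (htn : t (n + 1) = t 0 + 2 * π) {c : ℕ → ℝ}
    (hc : ∀ i < n + 1, c i * c (i + 1) < 0) :
    ∃ w : ℕ → ℝ, (∀ i < n + 1, 0 < w i * c i) ∧ (∀ i < n + 1, 1 < |w i|) ∧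
      ∀ v ∈ V, ∑ i ∈ Finset.range (n + 1), w i * v (t i : S1) = 0 := by
  obtain ⟨w, hw, hwV⟩ := hV.exists_alternating_relation (t := fun i : Fin (n + 1) => t i)
    (fun i j hij => ht hij) (by simpa [← htn] using ht (Nat.lt_succ_self n))
    (c := fun i => c i) (fun i => hc i (by omega))
  obtain ⟨Λ, hΛ⟩ := (finite_range fun i => |w i|⁻¹).bddAbove
  have hΛ' : ∀ i, |w i|⁻¹ < Λ + 1 := fun i => (hΛ (mem_range_self i)).trans_lt (lt_add_one Λ)
  have hpos : 0 < Λ + 1 := (inv_nonneg.2 (abs_nonneg (w 0))).trans_lt (hΛ' 0)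
  refine ⟨fun i => if h : i < n + 1 then (Λ + 1) * w ⟨i, h⟩ else 0, fun i hi => ?_, fun i hi => ?_,
    fun v hv => ?_⟩
  · simp only [dif_pos hi, mul_assoc]
    exact mul_pos hpos (hw ⟨i, hi⟩)
  · simp only [dif_pos hi, abs_mul, abs_of_pos hpos]
    exact (inv_lt_iff_one_lt_mul₀ (abs_pos.2 (left_ne_zero_of_mul (hw ⟨i, hi⟩).ne'))).1 (hΛ' _)
  · rw [Finset.sum_range]
    simp only [Fin.is_lt, dif_pos, Fin.eta, mul_assoc, ← Finset.mul_sum, hwV v hv, mul_zero]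

/-- The elements of a Chebyshev system dual to the evaluations at `n` points. -/
theorem exists_lagrange_basis (hV : IsChebyshevSystem n V) {t : ℕ → ℝ}
    (ht : StrictMono t) (htn : t (n + 1) = t 0 + 2 * π) :
    ∃ e : Fin n → C(S1, ℝ), (∀ j, e j ∈ V) ∧
      (∀ j k : Fin n, e j (t k : S1) = if k = j then 1 else 0) ∧
      ∀ v ∈ V, v = ∑ j : Fin n, v (t j : S1) • e j := by
  have hinj : Function.Injective fun k : Fin n => t k := ht.injective.comp Fin.val_injective
  have hmem : ∀ k : Fin n, t k ∈ Ico (t 0) (t 0 + 2 * π) := fun k =>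
    ⟨ht.monotone (Nat.zero_le _), htn ▸ ht (by omega)⟩
  choose e he hek using fun j : Fin n => hV.exists_forall_eq hinj hmem
    (fun k => if k = j then 1 else 0)
  refine ⟨e, he, hek, fun v hv => sub_eq_zero.1 (hV.eq_zero_of_forall_eq_zero hinj hmem
    (V.sub_mem hv (V.sum_mem fun j _ => V.smul_mem _ (he j))) fun k => ?_)⟩
  simp [ContinuousMap.sum_apply, hek]

end IsChebyshevSystem

/-! ### The moment map and its zero. -/

/-- Small steps at the points `t i`: if the widths of the steps are `ε * p z i`, where
`c i * p z i = w i + z i` and `w` is orthogonal to the functions `e j`, then the moments of the step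
function are approximately `ε * z j`. -/
theorem eventually_moment_pos {n : ℕ} {t c w : ℕ → ℝ} {e : Fin n → C(S1, ℝ)}
    (hek : ∀ j k : Fin n, e j (t k : S1) = if k = j then 1 else 0)
    (hwe : ∀ j, ∑ i ∈ Finset.range (n + 1), w i * e j (t i : S1) = 0)
    {p : EuclideanSpace ℝ (Fin n) → ℕ → ℝ} (hp : Continuous p)
    (hpc : ∀ z, ∀ i : Fin n, c i * p z i = w i + z i) (hpn : ∀ z, c n * p z n = w n) :
    ∀ᶠ ε in 𝓝[>] (0 : ℝ), ∀ z ∈ Metric.sphere (0 : EuclideanSpace ℝ (Fin n)) 1,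
      0 < ∑ j, (∑ i ∈ Finset.range (n + 1), c i * ∫ x in t i..(t i + ε * p z i), e j (x : S1)) *
        z j := by
  have hpi : ∀ i, Continuous fun z => p z i := fun i => (continuous_apply i).comp hp
  -- The moments divided by ε, after rescaling each interval to [0, 1]. This form is continuous up
  -- to ε = 0, where it equals z_j, so its inner product with z is 1 on the sphere.
  let H : Fin n → ℝ × EuclideanSpace ℝ (Fin n) → ℝ := fun j q =>
    ∑ i ∈ Finset.range (n + 1), c i * p q.2 i *
      ∫ x in (0 : ℝ)..1, e j ((t i + q.1 * p q.2 i * x : ℝ) : S1)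
  have hH : ∀ j, Continuous (H j) := by
    intro j
    refine continuous_finsetSum _ fun i _ => ?_
    have hpi' : Continuous fun q : ℝ × EuclideanSpace ℝ (Fin n) => p q.2 i :=
      (hpi i).comp continuous_snd
    refine (continuous_const.mul hpi').mul ?_
    apply intervalIntegral.continuous_parametric_intervalIntegral_of_continuous'
    refine (e j).continuous.comp ((AddCircle.continuous_mk' _).comp ?_)
    exact continuous_const.add (((continuous_fst.comp continuous_fst).mul
      (hpi'.comp continuous_fst)).mul continuous_snd)
  have hH0 : ∀ j z, H j (0, z) = z j := by
    intro j z
    have h1 : H j (0, z) = ∑ i ∈ Finset.range (n + 1), c i * p z i * e j (t i : S1) := by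
      simp [H]
    have h2 := hwe j
    rw [Finset.sum_range_succ, Finset.sum_range] at h1 h2
    rw [h1, hpn]
    simp only [hpc, add_mul, Finset.sum_add_distrib]
    have h3 : ∑ i : Fin n, z i * e j (t i : S1) = z j := by simp [hek]
    linarith
  have hQ : ∀ᶠ ε in 𝓝 (0 : ℝ), ∀ z ∈ Metric.sphere (0 : EuclideanSpace ℝ (Fin n)) 1,
      0 < ∑ j, H j (ε, z) * z j := by
    apply (isCompact_sphere _ _).eventually_forall_of_forall_eventually
    intro z hz
    have hc : Continuous fun q : ℝ × EuclideanSpace ℝ (Fin n) => ∑ j, H j (q.1, q.2) * q.2 j :=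
      continuous_finsetSum _ fun j _ => ((hH j).comp (continuous_fst.prodMk continuous_snd)).mul
        ((EuclideanSpace.proj j).continuous.comp continuous_snd)
    apply hc.continuousAt.eventually (lt_mem_nhds _)
    have hz1 : ‖z‖ ^ 2 = 1 := by rw [mem_sphere_zero_iff_norm.1 hz, one_pow]
    rw [EuclideanSpace.real_norm_sq_eq] at hz1
    simp only [hH0, ← pow_two, hz1, one_pos]
  filter_upwards [nhdsWithin_le_nhds hQ, self_mem_nhdsWithin] with ε hε hε0 z hz
  have h := mul_pos hε0 (hε z hz)
  rw [Finset.mul_sum] at h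
  refine lt_of_lt_of_eq h (Finset.sum_congr rfl fun j _ => ?_)
  rw [← mul_assoc, Finset.mul_sum]
  congr 1
  refine Finset.sum_congr rfl fun i _ => ?_
  have := intervalIntegral.mul_integral_comp_add_mul (a := 0) (b := 1)
    (f := fun x : ℝ => e j (x : S1)) (ε * p z i) (t i)
  rw [mul_zero, add_zero, mul_one] at this
  rw [← this]
  ring

/-- If `f` alternates in sign at the points `t i` and vanishes at the intermediate points `s i`,
a smooth approximation of a suitable step map makes `f` orthogonal to the functions `e j`. -/
theorem exists_stepLift_orthogonal {n : ℕ} (f : C(S1, ℝ)) {t s w : ℕ → ℝ} {e : Fin n → C(S1, ℝ)}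
    (ht : StrictMono t) (htn : t (n + 1) = t 0 + 2 * π) (hs : ∀ i < n + 1, f (s i : S1) = 0)
    (hek : ∀ j k : Fin n, e j (t k : S1) = if k = j then 1 else 0)
    (hwe : ∀ j, ∑ i ∈ Finset.range (n + 1), w i * e j (t i : S1) = 0)
    (hwf : ∀ i < n + 1, 0 < w i * f (t i : S1)) (hw : ∀ i < n + 1, 1 < |w i|) :
    ∃ (b : ℕ → ℝ) (r : ℝ), 0 < r ∧ r < 1 ∧ ∀ j,
      ∫ x in t 0..(t 0 + 2 * π), f (stepLift n t s b r x : S1) * e j (x : S1) = 0 := by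
  set c : ℕ → ℝ := fun i => f (t i : S1)
  have hc0 : ∀ i < n + 1, c i ≠ 0 := fun i hi => right_ne_zero_of_mul (hwf i hi).ne'
  -- Only n of the n + 1 widths are perturbed, one for each moment.
  let y : EuclideanSpace ℝ (Fin n) → ℕ → ℝ := fun z i => if h : i < n then z ⟨i, h⟩ else 0
  have hy : Continuous y := by
    refine continuous_pi fun i => ?_
    by_cases h : i < n
    · simp only [y, dif_pos h]
      exact (EuclideanSpace.proj (⟨i, h⟩ : Fin n)).continuous
    · simp only [y, dif_neg h]
      exact continuous_const
  let p : EuclideanSpace ℝ (Fin n) → ℕ → ℝ := fun z i => (w i + y z i) / c i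
  have hp : Continuous p := continuous_pi fun i =>
    (continuous_const.add ((continuous_apply i).comp hy)).div_const _
  have hcp : ∀ z, ∀ i < n + 1, c i * p z i = w i + y z i := fun z i hi =>
    mul_div_cancel₀ _ (hc0 i hi)
  have hppos : ∀ z ∈ Metric.sphere (0 : EuclideanSpace ℝ (Fin n)) 1, ∀ i < n + 1, 0 < p z i := by
    intro z hz i hi
    have h1 : |y z i| ≤ 1 := by
      by_cases h : i < n
      · simp only [y, dif_pos h]
        rw [← mem_sphere_zero_iff_norm.1 hz]
        exact PiLp.norm_apply_le z _
      · simp [y, dif_neg h]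
    have h2 := hw i hi
    have h3 := hwf i hi
    have h4 := abs_le.1 h1
    rcases lt_or_gt_of_ne (hc0 i hi) with h | h
    · have h5 : w i < 0 := neg_of_mul_pos_left h3 h.le
      rw [abs_of_neg h5] at h2
      exact div_pos_of_neg_of_neg (by linarith) h
    · have h5 : 0 < w i := pos_of_mul_pos_left h3 h.le
      rw [abs_of_pos h5] at h2
      exact div_pos (by linarith) h
  have hsmall : ∀ᶠ ε in 𝓝 (0 : ℝ), ∀ z ∈ Metric.sphere (0 : EuclideanSpace ℝ (Fin n)) 1,
      ∀ i ∈ Finset.range (n + 1), t i + ε * p z i < t (i + 1) := by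
    apply (isCompact_sphere _ _).eventually_forall_of_forall_eventually
    intro z _
    rw [Filter.eventually_all_finset]
    intro i _
    have hcont : Continuous fun q : ℝ × EuclideanSpace ℝ (Fin n) => t i + q.1 * p q.2 i :=
      continuous_const.add (continuous_fst.mul ((continuous_apply i).comp (hp.comp continuous_snd)))
    apply hcont.continuousAt.eventually (gt_mem_nhds _)
    simpa using ht (Nat.lt_succ_self i)
  have hmoment := eventually_moment_pos (c := c) hek hwe hp
    (fun z i => by simp [hcp z i (by omega), y]) (fun z => by simp [hcp z n (by omega), y])
  obtain ⟨ε, hεQ, hεs, hε0⟩ := (hmoment.and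
    ((hsmall.filter_mono nhdsWithin_le_nhds).and self_mem_nhdsWithin)).exists
  let b : EuclideanSpace ℝ (Fin n) → ℕ → ℝ := fun z i => t i + ε * p z i
  have hb : Continuous b := continuous_pi fun i =>
    continuous_const.add (continuous_const.mul ((continuous_apply i).comp hp))
  let J : Fin n → ℝ × EuclideanSpace ℝ (Fin n) → ℝ := fun j q =>
    ∫ x in t 0..(t 0 + 2 * π), f (stepLift n t s (b q.2) q.1 x : S1) * e j (x : S1)
  have hJ : ∀ j r z, 0 < r → r ≤ 1 → ContinuousAt (J j) (r, z) := fun j r z hr0 hr1 =>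
    continuousAt_integral_stepLift f (e j) n t s hb hr0 hr1 z _ _
  -- Outward pointing holds at r = 1 by the exact step computation and persists nearby by
  -- compactness of the sphere.
  have hpos : ∀ᶠ r in 𝓝 (1 : ℝ), ∀ z ∈ Metric.sphere (0 : EuclideanSpace ℝ (Fin n)) 1,
      0 < ∑ j, J j (r, z) * z j := by
    apply (isCompact_sphere _ _).eventually_forall_of_forall_eventually
    intro z hz
    have hcont : ContinuousAt (fun q : ℝ × EuclideanSpace ℝ (Fin n) => ∑ j, J j q * q.2 j) (1, z) :=
      tendsto_finsetSum _ fun j _ => (hJ j 1 z one_pos le_rfl).mul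
        ((EuclideanSpace.proj j).continuous.comp continuous_snd).continuousAt
    apply hcont.eventually (lt_mem_nhds _)
    refine lt_of_lt_of_eq (hεQ z hz) (Finset.sum_congr rfl fun j _ => ?_)
    simp only [J]
    rw [integral_stepLift_one f (e j) ht htn
      (fun i hi => lt_add_of_pos_right _ (mul_pos hε0 (hppos z hz i hi)))
      (fun i hi => hεs z hz i (Finset.mem_range.2 hi)) hs]
  have hr0' : ∀ᶠ r : ℝ in 𝓝 1, 0 < r := lt_mem_nhds one_pos
  obtain ⟨r, ⟨hrpos, hr0⟩, hr1⟩ := (((hpos.and hr0').filter_mono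
    (nhdsWithin_le_nhds (s := Iio 1))).and self_mem_nhdsWithin).exists
  let F : EuclideanSpace ℝ (Fin n) → EuclideanSpace ℝ (Fin n) := fun z =>
    WithLp.toLp 2 fun j => J j (r, z)
  have hF : Continuous F := by
    refine (PiLp.continuous_toLp 2 _).comp (continuous_pi fun j => ?_)
    refine continuous_iff_continuousAt.2 fun z => ?_
    exact (hJ j r z hr0 (le_of_lt hr1)).comp (f := fun z => (r, z))
      (continuous_const.prodMk continuous_id).continuousAt
  -- The bound on z can be dropped: monotonicity of `stepLift` for r < 1 puts no condition on the
  -- points b_i, whose position matters only on the sphere.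
  obtain ⟨z, -, hz⟩ := exists_zero_of_inner_pos hF fun z hz => by
    rw [PiLp.inner_apply]
    refine lt_of_lt_of_eq (hrpos z (mem_sphere_zero_iff_norm.2 hz))
      (Finset.sum_congr rfl fun j _ => ?_)
    simp [F, mul_comm]
  exact ⟨b z, r, hr0, hr1, fun j => congrArg (fun u : EuclideanSpace ℝ (Fin n) => u j) hz⟩

theorem theorem1 (n : ℕ) (V : Submodule ℝ C(S1, ℝ)) (hV : IsChebyshevSystem n V)
    (f : C(S1, ℝ)) (hf : HasAtLeastSignChanges f (n + 1)) :
    ∃ φ : S1 → S1, IsOrientationPreservingDiffeo φ ∧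
      ∀ v ∈ V, ∫ x in (0 : ℝ)..(2 * π), f (φ (x : S1)) * v (x : S1) = 0 := by
  obtain ⟨t, ht, htn, hft⟩ := hf.exists_strictMono hV.odd
  have hzero : ∀ i, ∃ z, i < n + 1 → t i < z ∧ z < t (i + 1) ∧ f (z : S1) = 0 := by
    intro i
    by_cases hi : i < n + 1
    · have hcont : ContinuousOn (fun x : ℝ => f (x : S1)) (Icc (t i) (t (i + 1))) :=
        (f.continuous.comp (AddCircle.continuous_mk' _)).continuousOn
      have hlt := ht (Nat.lt_succ_self i)
      rcases mul_neg_iff.1 (hft i hi) with h | h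
      · obtain ⟨z, hz, hz0⟩ := intermediate_value_Ioo' hlt.le hcont ⟨h.2, h.1⟩
        exact ⟨z, fun _ => ⟨hz.1, hz.2, hz0⟩⟩
      · obtain ⟨z, hz, hz0⟩ := intermediate_value_Ioo hlt.le hcont ⟨h.1, h.2⟩
        exact ⟨z, fun _ => ⟨hz.1, hz.2, hz0⟩⟩
    · exact ⟨0, fun h => absurd h hi⟩
  choose s hs using hzero
  obtain ⟨w, hwf, hw1, hwV⟩ := hV.exists_alternating_relation_one_lt ht htn hft
  obtain ⟨e, he, hek, heV⟩ := hV.exists_lagrange_basis ht htn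
  obtain ⟨b, r, hr0, hr1, hb⟩ := exists_stepLift_orthogonal f ht htn (fun i hi => (hs i hi).2.2)
    hek (fun j => hwV _ (he j)) hwf hw1
  obtain ⟨φ, hφ, hφx⟩ := exists_diffeo_stepLift (b := b) hr0 hr1 (fun i hi => (hs i hi).1)
    (fun i hi => (hs i hi).2.1) htn
  refine ⟨φ, hφ, fun v hv => ?_⟩
  have hper : Function.Periodic (fun x : ℝ => f (φ (x : S1)) * v (x : S1)) (2 * π) := fun x => by
    simp only [AddCircle.coe_add_period]
  -- By periodicity the integral may start at t_0; expanding v in the dual basis then leaves only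
  -- the vanishing moments.
  have h := hper.intervalIntegral_add_eq 0 (t 0)
  rw [zero_add] at h
  rw [h, heV v hv]
  have hexp : ∀ x : ℝ, f (φ (x : S1)) * (∑ j : Fin n, v (t j : S1) • e j) (x : S1) =
      ∑ j : Fin n, v (t j : S1) * (f (stepLift n t s b r x : S1) * e j (x : S1)) := by
    intro x
    simp only [hφx, ContinuousMap.sum_apply, ContinuousMap.smul_apply, smul_eq_mul, Finset.mul_sum]
    exact Finset.sum_congr rfl fun j _ => by ring
  simp only [hexp]
  rw [intervalIntegral.integral_finsetSum fun j _ =>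
    (intervalIntegrable_stepLift_integrand f (e j) n t s b r _ _).const_mul _]
  simp [intervalIntegral.integral_const_mul, hb]
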